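/- **Cographs and siblings.** All graphs are finite, simple and undirected. Cographs are the graphs obtained from one-vertex graphs by repeatedly forming the union $G_1+\dots+G_k$ (disjoint union) or the join $G_1*\dots*G_k$ (disjoint union together with all edges between different $G_i$) of $k>1$ cographs. The *cotree* of a cograph $G$ is the rooted tree whose leaves are the nodes of $G$, whose internal nodes have at least two children and are labelled $0$ or $1$, the labels alternating along every path from a leaf to the root, such that $G$ is recovered from the tree by reading each internal node labelled $0$ as the union, and each internal node labelled $1$ as the join, of the graphs given by its children. Two nodes of $G$ are *siblings* if their leaves have the same parent in the cotree. The *sibling partition* of $G$ is the partition of the node set in which two nodes lie in the same cell if and only if they are siblings. **Controllability.** For a graph $G$ on $n$ nodes with Laplacian matrix $L(G)$ and a set $V_C=\{j_1,\dots,j_m\}$ of *control nodes*, consider the system $\dot x=-L(G)x+Bu$ with $B=[e_{j_1},\dots,e_{j_m}]\in\mathbb{R}^{n\times m}$, where $e_j$ is the $j$-th standard basis vector. The network is controllable from $V_C$ if every initial state $x_0\in\mathbb R^n$ can be steered to every final state $x_1\in\mathbb R^n$ in finite time by some (continuous) input $u$. **Theorem.** Let $G$ be a connected cograph with $n>1$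 nodes. Then $G$ has exactly one sibling partition $\{\mathcal C_1,\dots,\mathcal C_p\}$; let $m_i=|\mathcal C_i|$. The minimum number of control nodes from which the network is controllable is $n-p$. Moreover, a set of $n-p$ control nodes makes the network controllable if and only if it consists of exactly $m_i-1$ nodes from each cell $\mathcal C_i$, $1\le i\le p$. Consequently there are exactly $\prod_{i=1}^p m_i$ sets of control nodes of minimum size from which the network is controllable. -/

import Mathlib

universe u

/-- Cographs. A one-vertex graph is a cograph, and so are the union `G₁ + ⋯ + Gₖ` and the join
`G₁ * ⋯ * Gₖ` of `k > 1` cographs. The vertex set of the union or join is split by `f` into the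
nonempty vertex sets of `G₁, …, Gₖ`; the `Gᵢ` are the subgraphs induced on the fibres of `f`, and
between different fibres there are no edges (union) or all edges (join). -/
inductive IsCograph : {V : Type u} → SimpleGraph V → Prop
  | single {V : Type u} (G : SimpleGraph V) (v : V) (hv : ∀ w : V, w = v) : IsCograph G
  | union {V : Type u} (G : SimpleGraph V) (k : ℕ) (hk : 1 < k) (f : V → Fin k)
      (hf : Function.Surjective f)
      (hG : ∀ i : Fin k, IsCograph (G.induce {v | f v = i}))
      (hcross : ∀ v w : V, f v ≠ f w → ¬ G.Adj v w) : IsCograph G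
  | join {V : Type u} (G : SimpleGraph V) (k : ℕ) (hk : 1 < k) (f : V → Fin k)
      (hf : Function.Surjective f)
      (hG : ∀ i : Fin k, IsCograph (G.induce {v | f v = i}))
      (hcross : ∀ v w : V, f v ≠ f w → G.Adj v w) : IsCograph G

/-- Finite rooted trees whose leaves carry elements of `V` and whose internal nodes carry a label:
`true` is the label 1 (join), `false` is the label 0 (union). -/
inductive Cotree (V : Type u) : Type u
  | leaf (v : V) : Cotree V
  | node (label : Bool) (k : ℕ) (child : Fin k → Cotree V) : Cotree V

namespace Cotree

variable {V : Type u}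

/-- The vertices at the leaves of the tree. -/
def leaves : Cotree V → Set V
  | leaf v => {v}
  | node _ _ child => ⋃ i, (child i).leaves

/-- Every internal node has at least two children, and different children have disjoint sets of
leaves (so that no vertex occurs at two leaves). -/
def Proper : Cotree V → Prop
  | leaf _ => True
  | node _ k child =>
      1 < k ∧ (Pairwise fun i j => Disjoint (child i).leaves (child j).leaves) ∧
        ∀ i, (child i).Proper

/-- The label of the root, if the root is an internal node. -/
def rootLabel : Cotree V → Option Bool
  | leaf _ => none
  | node label _ _ => some label

/-- The labels alternate along every path of internal nodes. -/
def Alternating : Cotree V → Prop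
  | leaf _ => True
  | node label _ child => ∀ i, (child i).rootLabel ≠ some label ∧ (child i).Alternating

/-- Adjacency in the graph built by the tree: a node labelled 0 is the union, and a node labelled 1
the join, of the graphs of its children. -/
def Adj : Cotree V → V → V → Prop
  | leaf _, _, _ => False
  | node label _ child, v, w =>
      (∃ i, (child i).Adj v w) ∨
        (label = true ∧ ∃ i j, i ≠ j ∧ v ∈ (child i).leaves ∧ w ∈ (child j).leaves)

/-- The leaves `v` and `w` have the same parent in the tree. -/
def SameParent : Cotree V → V → V → Prop
  | leaf _, _, _ => False
  | node _ _ child, v, w =>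
      (∃ i, (child i).SameParent v w) ∨ ((∃ i, child i = leaf v) ∧ ∃ j, child j = leaf w)

/-- `T` is the (alternating) cotree of the graph `G`. -/
structure IsCotreeOf (T : Cotree V) (G : SimpleGraph V) : Prop where
  proper : T.Proper
  alternating : T.Alternating
  leaves_eq : T.leaves = Set.univ
  adj_iff : ∀ v w : V, T.Adj v w ↔ G.Adj v w

end Cotree

/-- Two vertices are siblings if their leaves have the same parent in the cotree of `G`. -/
def Siblings {V : Type u} (G : SimpleGraph V) (v w : V) : Prop :=
  ∃ T : Cotree V, T.IsCotreeOf G ∧ T.SameParent v w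

/-- `π` is the sibling partition of `G`: two vertices lie in a common cell iff they are siblings. -/
def IsSiblingPartition {V : Type u} [Fintype V] [DecidableEq V] (G : SimpleGraph V)
    (π : Finpartition (Finset.univ : Finset V)) : Prop :=
  ∀ v w : V, (∃ C ∈ π.parts, v ∈ C ∧ w ∈ C) ↔ Siblings G v w

/-- Controllability of the system `ẋ = A x + B u`: every initial state can be steered to every final
state in finite time by a continuous input. -/
def IsControllable {N M : Type*} [Fintype N] [Fintype M] (A : Matrix N N ℝ) (B : Matrix N M ℝ) :
    Prop :=
  ∀ x₀ x₁ : N → ℝ, ∃ T : ℝ, 0 < T ∧ ∃ (u : ℝ → M → ℝ) (x : ℝ → N → ℝ),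
    ContinuousOn u (Set.Icc 0 T) ∧
    (∀ t ∈ Set.Icc 0 T,
      HasDerivWithinAt x (A.mulVec (x t) + B.mulVec (u t)) (Set.Icc 0 T) t) ∧
    x 0 = x₀ ∧ x T = x₁

/-- The input matrix with one column `e_j` for each control node `j ∈ S`. -/
def inputMatrix {V : Type u} [DecidableEq V] (S : Finset V) : Matrix V S ℝ :=
  Matrix.of fun v j => if v = (j : V) then 1 else 0

/-- The network `ẋ = -L(G) x + B u` is controllable from the set `S` of control nodes. -/
def ControllableFrom {V : Type u} [Fintype V] [DecidableEq V] (G : SimpleGraph V)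
    [DecidableRel G.Adj] (S : Finset V) : Prop :=
  IsControllable (-(G.lapMatrix ℝ)) (inputMatrix S)

/-!
Two vertices are *twins* if no third vertex distinguishes them. Reading off adjacency at the lowest
common ancestor in an alternating cotree shows that in a cograph with more than one vertex siblings
are the same as twins (`siblings_iff_twins`). Being twins is an equivalence relation in every graph,
whence the sibling partition.

Controllability is decided by the Hautus test (`isControllable_of_isSymm`, `IsControllable.eq_zero`):
since the Laplacian `L` is symmetric, the network is controllable from `S` if and only if no
eigenvector of `L` vanishes on `S`. If `v` and `w` are twins, then `e_v - e_w` is an eigenvector, so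
that `S` must contain all but at most one vertex of each cell. Conversely, let `S` be such a set. A
set of at least two vertices of a cograph can be cut into two parts with no edges or with all edges
between them, and one cuts the vertex set recursively into ever smaller modules (sets that no outside
vertex distinguishes). The claim `eq_zero_of_eigenvector` is that on each module an eigenvector of the
induced Laplacian vanishes if its sum is zero and it vanishes on `S`. Up to passing to the
complementary graph, which on vectors with zero sum only replaces the eigenvalue `μ` by `|s| - μ`,
there are no edges between the two parts. If `μ ≠ 0`, then the restrictions to the parts are again
eigenvectors with zero sum. If `μ = 0`, then the vector is constant along edges, so its support is a
module disjoint from `S`; but a module with at least two vertices contains a pair of twins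
(`IsModule.exists_twins`), one of which lies in `S`. So the support has at most one vertex, and is
empty because the sum is zero.

Thus the controlling sets are those that miss at most one vertex of each cell, and the rest is
counting.
-/

/-! ### Twins, modules and splittings -/

section Twins

variable {V : Type u} {G : SimpleGraph V}

/-- Two vertices are twins if every third vertex is adjacent to both or to neither of them. They may
or may not be adjacent to each other, and every vertex is its own twin. -/
def Twins (G : SimpleGraph V) (v w : V) : Prop :=
  ∀ u, u ≠ v → u ≠ w → (G.Adj u v ↔ G.Adj u w)

theorem Twins.refl (G : SimpleGraph V) (v : V) : Twins G v v := fun _ _ _ => Iff.rfl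

theorem Twins.symm {v w : V} (h : Twins G v w) : Twins G w v := fun u hw hv => (h u hv hw).symm

theorem Twins.trans {v w z : V} (h₁ : Twins G v w) (h₂ : Twins G w z) : Twins G v z := by
  intro u huv huz
  by_cases huw : u = w
  · subst huw
    by_cases hvz : v = z
    · rw [hvz]
    · -- each of the three pairs is compared with another one through the third vertex
      have e₁ := h₁ z (Ne.symm hvz) (Ne.symm huz)
      have e₂ := h₂ v (Ne.symm huv) hvz
      rw [G.adj_comm u v, e₂, G.adj_comm v z, e₁, G.adj_comm z u]
  · exact (h₁ u huv huw).trans (h₂ u huw huz)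

theorem twins_compl {v w : V} : Twins Gᶜ v w ↔ Twins G v w := by
  refine forall_congr' fun u => forall_congr' fun hv => forall_congr' fun hw => ?_
  simp only [SimpleGraph.compl_adj, ne_eq, hv, hw, not_false_eq_true, true_and, not_iff_not]

/-- A module (homogeneous set): no vertex outside `s` distinguishes two vertices of `s`. -/
def IsModule (G : SimpleGraph V) (s : Finset V) : Prop :=
  ∀ u, u ∉ s → ∀ v ∈ s, ∀ w ∈ s, (G.Adj u v ↔ G.Adj u w)

theorem isModule_compl {s : Finset V} : IsModule Gᶜ s ↔ IsModule G s := by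
  refine forall_congr' fun u => forall_congr' fun hu => forall₂_congr fun v hv =>
    forall₂_congr fun w hw => ?_
  have h₁ : u ≠ v := fun h => hu (h ▸ hv)
  have h₂ : u ≠ w := fun h => hu (h ▸ hw)
  simp only [SimpleGraph.compl_adj, ne_eq, h₁, h₂, not_false_eq_true, true_and, not_iff_not]

/-- A subset of a module that is joined to the rest of the module by no edges, or by all possible
edges, is again a module. -/
theorem IsModule.subset {s t : Finset V} (hs : IsModule G s) (hts : t ⊆ s) (p : Prop)
    (h : ∀ v ∈ t, ∀ w ∈ s, w ∉ t → (G.Adj v w ↔ p)) : IsModule G t := by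
  intro u hu v hv w hw
  by_cases hus : u ∈ s
  · rw [G.adj_comm u v, G.adj_comm u w, h v hv u hus hu, h w hw u hus hu]
  · exact hs u hus v (hts hv) w (hts hw)

/-- Every set of at least two vertices can be cut into two nonempty parts with either no edges or
all edges between them. Cographs are exactly the nonempty finite graphs with this property. -/
def HasSplits (G : SimpleGraph V) : Prop :=
  ∀ s : Set V, s.Nontrivial → ∃ t ⊆ s, t.Nonempty ∧ (s \ t).Nonempty ∧
    ∃ b : Bool, ∀ v ∈ t, ∀ w ∈ s \ t, (G.Adj v w ↔ b = true)

theorem HasSplits.of_fibres {k : ℕ} (f : V → Fin k) (b : Bool)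
    (hG : ∀ i : Fin k, HasSplits (G.induce {v | f v = i}))
    (hcross : ∀ v w : V, f v ≠ f w → (G.Adj v w ↔ b = true)) : HasSplits G := by
  rintro s ⟨x, hx, y, hy, hxy⟩
  by_cases hf : ∃ z ∈ s, f z ≠ f x
  · obtain ⟨z, hz, hzx⟩ := hf
    refine ⟨{v ∈ s | f v = f x}, fun v hv => hv.1, ⟨x, hx, rfl⟩, ⟨z, hz, fun h => hzx h.2⟩, b, ?_⟩
    rintro v ⟨-, hv⟩ w ⟨hw, hw'⟩
    exact hcross v w fun h => hw' ⟨hw, by rw [← h, hv]⟩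
  · push Not at hf
    obtain ⟨t, hts, ⟨a, ha⟩, ⟨c, hc, hct⟩, b', hb⟩ :=
      hG (f x) (Subtype.val ⁻¹' s) ⟨⟨x, rfl⟩, hx, ⟨y, hf y hy⟩, hy, by simpa using hxy⟩
    refine ⟨Subtype.val '' t, ?_, ⟨a, a, ha, rfl⟩, ⟨c, hc, ?_⟩, b', ?_⟩
    · rintro _ ⟨v, hv, rfl⟩
      exact hts hv
    · rintro ⟨v, hv, h⟩
      exact hct (Subtype.ext h ▸ hv)
    · rintro _ ⟨v, hv, rfl⟩ w ⟨hw, hwt⟩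
      exact hb v hv ⟨w, hf w hw⟩ ⟨hw, fun h => hwt ⟨_, h, rfl⟩⟩

theorem IsCograph.hasSplits (h : IsCograph G) : HasSplits G := by
  induction h with
  | single G v hv =>
    rintro s ⟨x, -, y, -, hxy⟩
    exact absurd ((hv x).trans (hv y).symm) hxy
  | union G k hk f hf hG hcross ih =>
    exact .of_fibres f false ih fun v w h => by simpa using hcross v w h
  | join G k hk f hf hG hcross ih =>
    exact .of_fibres f true ih fun v w h => by simpa using hcross v w h

theorem HasSplits.compl (h : HasSplits G) : HasSplits Gᶜ := by
  intro s hs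
  obtain ⟨t, hts, ht, hst, b, hb⟩ := h s hs
  refine ⟨t, hts, ht, hst, !b, fun v hv w hw => ?_⟩
  have : v ≠ w := fun e => hw.2 (e ▸ hv)
  simp [SimpleGraph.compl_adj, this, hb v hv w hw]

theorem HasSplits.exists_finset [DecidableEq V] (h : HasSplits G) {s : Finset V}
    (hs : s.Nontrivial) :
    ∃ t ⊂ s, t.Nonempty ∧ ∃ b : Bool, ∀ v ∈ t, ∀ w ∈ s, w ∉ t → (G.Adj v w ↔ b = true) := by
  obtain ⟨t, hts, ⟨a, ha⟩, ⟨c, hc, hct⟩, b, hb⟩ := h (s : Set V) hs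
  obtain ⟨t, rfl⟩ := (s.finite_toSet.subset hts).exists_finset_coe
  exact ⟨t, ⟨by exact_mod_cast hts, fun h => hct (h hc)⟩, ⟨a, ha⟩, b,
    fun v hv w hw hwt => hb v hv w ⟨hw, hwt⟩⟩

/-- A module with at least two vertices contains two distinct twins: split it until two vertices are
left. -/
theorem IsModule.exists_twins [DecidableEq V] (hG : HasSplits G) {s : Finset V}
    (hs : IsModule G s) (hnt : s.Nontrivial) : ∃ v ∈ s, ∃ w ∈ s, v ≠ w ∧ Twins G v w := by
  induction s using Finset.strongInduction with
  | H s ih =>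
    obtain ⟨t, hts, ⟨a, ha⟩, b, hb⟩ := hG.exists_finset hnt
    by_cases ht : t.Nontrivial
    · obtain ⟨v, hv, w, hw, h⟩ := ih t hts (hs.subset hts.1 _ hb) ht
      exact ⟨v, hts.1 hv, w, hts.1 hw, h⟩
    by_cases ht' : (s \ t).Nontrivial
    · have hss : s \ t ⊂ s := Finset.sdiff_ssubset hts.1 ⟨a, ha⟩
      obtain ⟨v, hv, w, hw, h⟩ := ih (s \ t) hss (hs.subset hss.1 (b = true) (by
        intro v hv w hw hwt
        simp only [Finset.mem_sdiff] at hv hwt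
        rw [G.adj_comm]
        exact hb w (by tauto) v hv.1 hv.2)) ht'
      exact ⟨v, hss.1 hv, w, hss.1 hw, h⟩
    · obtain ⟨c, hc, hct⟩ := Finset.exists_of_ssubset hts
      refine ⟨a, hts.1 ha, c, hc, fun e => hct (e ▸ ha), fun u hua huc => ?_⟩
      refine hs u (fun hu => ?_) a (hts.1 ha) c hc
      by_cases hut : u ∈ t
      · exact ht ⟨u, hut, a, ha, hua⟩
      · exact ht' ⟨u, by simp [hu, hut], c, by simp [hc, hct], huc⟩

end Twins

/-! ### Cotrees -/

namespace Cotree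

variable {V : Type u}

theorem mem_leaves_node {b : Bool} {k : ℕ} {c : Fin k → Cotree V} {v : V} :
    v ∈ (node b k c).leaves ↔ ∃ i, v ∈ (c i).leaves := by
  simp [leaves]

theorem Proper.nonempty_leaves {T : Cotree V} (hT : T.Proper) : T.leaves.Nonempty := by
  induction T with
  | leaf v => exact ⟨v, rfl⟩
  | node b k c ih =>
    obtain ⟨v, hv⟩ := ih ⟨0, by have := hT.1; omega⟩ (hT.2.2 _)
    exact ⟨v, mem_leaves_node.2 ⟨_, hv⟩⟩

theorem Adj.mem_leaves {T : Cotree V} {v w : V} (h : T.Adj v w) :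
    v ∈ T.leaves ∧ w ∈ T.leaves := by
  induction T with
  | leaf v => exact h.elim
  | node b k c ih =>
    simp only [mem_leaves_node]
    rcases h with ⟨i, h⟩ | ⟨-, i, j, -, hi, hj⟩
    · exact ⟨⟨i, (ih i h).1⟩, ⟨i, (ih i h).2⟩⟩
    · exact ⟨⟨i, hi⟩, ⟨j, hj⟩⟩

theorem SameParent.mem_leaves {T : Cotree V} {v w : V} (h : T.SameParent v w) :
    v ∈ T.leaves ∧ w ∈ T.leaves := by
  induction T with
  | leaf v => exact h.elim
  | node b k c ih =>
    simp only [mem_leaves_node]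
    rcases h with ⟨i, h⟩ | ⟨⟨i, hi⟩, ⟨j, hj⟩⟩
    · exact ⟨⟨i, (ih i h).1⟩, ⟨i, (ih i h).2⟩⟩
    · exact ⟨⟨i, by rw [hi]; rfl⟩, ⟨j, by rw [hj]; rfl⟩⟩

theorem Proper.index_unique {b : Bool} {k : ℕ} {c : Fin k → Cotree V} (hT : (node b k c).Proper)
    {v : V} {i j : Fin k} (hi : v ∈ (c i).leaves) (hj : v ∈ (c j).leaves) : i = j := by
  by_contra h
  exact Set.disjoint_left.1 (hT.2.1 h) hi hj

theorem Proper.adj_same {b : Bool} {k : ℕ} {c : Fin k → Cotree V} (hT : (node b k c).Proper)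
    {v w : V} {i : Fin k} (hv : v ∈ (c i).leaves) (hw : w ∈ (c i).leaves) :
    (node b k c).Adj v w ↔ (c i).Adj v w := by
  constructor
  · rintro (⟨j, h⟩ | ⟨-, j, l, hjl, hj, hl⟩)
    · rwa [hT.index_unique hv h.mem_leaves.1]
    · exact absurd ((hT.index_unique hj hv).trans (hT.index_unique hw hl)) hjl
  · exact fun h => .inl ⟨i, h⟩

theorem Proper.adj_cross {b : Bool} {k : ℕ} {c : Fin k → Cotree V} (hT : (node b k c).Proper)
    {v w : V} {i j : Fin k} (hij : i ≠ j) (hv : v ∈ (c i).leaves) (hw : w ∈ (c j).leaves) :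
    (node b k c).Adj v w ↔ b = true := by
  constructor
  · rintro (⟨l, h⟩ | ⟨h, -⟩)
    · exact absurd ((hT.index_unique hv h.mem_leaves.1).trans
        (hT.index_unique h.mem_leaves.2 hw)) hij
    · exact h
  · exact fun h => .inr ⟨h, i, j, hij, hv, hw⟩

/-- Siblings cannot be distinguished by a third leaf. -/
theorem SameParent.adj_iff {T : Cotree V} (hT : T.Proper) {v w : V} (h : T.SameParent v w) {u : V}
    (hu : u ∈ T.leaves) (huv : u ≠ v) (huw : u ≠ w) : T.Adj u v ↔ T.Adj u w := by
  induction T with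
  | leaf v => exact h.elim
  | node b k c ih =>
    obtain ⟨l, hl⟩ := mem_leaves_node.1 hu
    rcases h with ⟨i, h⟩ | ⟨⟨i, hi⟩, ⟨j, hj⟩⟩
    · obtain ⟨hv, hw⟩ := h.mem_leaves
      by_cases hil : l = i
      · subst hil
        rw [hT.adj_same hl hv, hT.adj_same hl hw]
        exact ih l (hT.2.2 l) h hl
      · rw [hT.adj_cross hil hl hv, hT.adj_cross hil hl hw]
    · have hv : v ∈ (c i).leaves := by rw [hi]; rfl
      have hw : w ∈ (c j).leaves := by rw [hj]; rfl
      have hli : l ≠ i := by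
        rintro rfl
        rw [hi] at hl
        exact huv hl
      have hlj : l ≠ j := by
        rintro rfl
        rw [hj] at hl
        exact huw hl
      rw [hT.adj_cross hli hl hv, hT.adj_cross hlj hl hw]

/-- If a leaf `v` below the child `i` of the root and a leaf `w` below another child are not
distinguished by any third leaf, then the child `i` is the leaf `v`: otherwise its label differs from
that of the root, and a leaf that meets `v` at the child `i` distinguishes `v` from `w`. -/
theorem child_eq_leaf_of_twins {b : Bool} {k : ℕ} {c : Fin k → Cotree V}
    (hT : (node b k c).Proper) (hA : (node b k c).Alternating) {v w : V} {i j : Fin k}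
    (hij : i ≠ j) (hv : v ∈ (c i).leaves) (hw : w ∈ (c j).leaves)
    (h : ∀ u ∈ (node b k c).leaves, u ≠ v → u ≠ w →
      ((node b k c).Adj u v ↔ (node b k c).Adj u w)) : c i = leaf v := by
  cases hc : c i with
  | leaf v' =>
    rw [hc] at hv
    rw [show v = v' from hv]
  | node b' k' c' =>
    have hP := hT.2.2 i
    have hb : b' ≠ b := fun e => (hA i).1 (by rw [hc, e]; rfl)
    rw [hc] at hP
    have hv' := hv
    rw [hc] at hv'
    obtain ⟨a, ha⟩ := mem_leaves_node.1 hv'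
    have : Nontrivial (Fin k') := Fin.nontrivial_iff_two_le.2 hP.1
    obtain ⟨d, hd⟩ := exists_ne a
    obtain ⟨u, hu⟩ := (hP.2.2 d).nonempty_leaves
    have hui : u ∈ (c i).leaves := by
      rw [hc]
      exact mem_leaves_node.2 ⟨d, hu⟩
    have huv : u ≠ v := by
      rintro rfl
      exact hd (hP.index_unique hu ha)
    have huw : u ≠ w := by
      rintro rfl
      exact hij (hT.index_unique hui hw)
    have := h u (mem_leaves_node.2 ⟨i, hui⟩) huv huw
    rw [hT.adj_same hui hv, hT.adj_cross hij hui hw, hc, hP.adj_cross hd hu ha] at this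
    revert hb this
    cases b <;> cases b' <;> simp

theorem sameParent_of_twins {T : Cotree V} (hT : T.Proper) (hA : T.Alternating) {v w : V}
    (hvw : v ≠ w) (hv : v ∈ T.leaves) (hw : w ∈ T.leaves)
    (h : ∀ u ∈ T.leaves, u ≠ v → u ≠ w → (T.Adj u v ↔ T.Adj u w)) : T.SameParent v w := by
  induction T with
  | leaf x => exact absurd ((show v = x from hv).trans (show w = x from hw).symm) hvw
  | node b k c ih =>
    obtain ⟨i, hi⟩ := mem_leaves_node.1 hv
    obtain ⟨j, hj⟩ := mem_leaves_node.1 hw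
    by_cases hij : i = j
    · subst hij
      refine .inl ⟨i, ih i (hT.2.2 i) (hA i).2 hi hj fun u hu huv huw => ?_⟩
      rw [← hT.adj_same hu hi, ← hT.adj_same hu hj]
      exact h u (mem_leaves_node.2 ⟨i, hu⟩) huv huw
    · exact .inr ⟨⟨i, child_eq_leaf_of_twins hT hA hij hi hj h⟩,
        ⟨j, child_eq_leaf_of_twins hT hA (Ne.symm hij) hj hi
          fun u hu huw huv => (h u hu huv huw).symm⟩⟩

theorem sameParent_self {T : Cotree V} {v : V} (hv : v ∈ T.leaves) (hT : ∀ x, T ≠ leaf x) :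
    T.SameParent v v := by
  induction T with
  | leaf x => exact absurd rfl (hT x)
  | node b k c ih =>
    obtain ⟨i, hi⟩ := mem_leaves_node.1 hv
    by_cases hc : ∃ x, c i = leaf x
    · obtain ⟨x, hx⟩ := hc
      have : c i = leaf v := by
        rw [hx] at hi ⊢
        rw [show v = x from hi]
      exact .inr ⟨⟨i, this⟩, ⟨i, this⟩⟩
    · exact .inl ⟨i, ih i hi fun x hx => hc ⟨x, hx⟩⟩

/-- `T` is a proper alternating cotree of the subgraph of `G` induced on `s`. -/
structure Represents (T : Cotree V) (G : SimpleGraph V) (s : Set V) : Prop where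
  proper : T.Proper
  alternating : T.Alternating
  leaves_eq : T.leaves = s
  adj_iff : ∀ v ∈ s, ∀ w ∈ s, (T.Adj v w ↔ G.Adj v w)

/-- The trees `c i` can serve as the children of a node labelled `b` in a cotree of the subgraph of
`G` induced on `s`; a single child is allowed. -/
structure IsForest {ι : Type} (c : ι → Cotree V) (b : Bool) (G : SimpleGraph V) (s : Set V) :
    Prop where
  proper : ∀ i, (c i).Proper
  alternating : ∀ i, (c i).rootLabel ≠ some b ∧ (c i).Alternating
  disjoint : Pairwise fun i j => Disjoint (c i).leaves (c j).leaves
  mem_iff : ∀ v, v ∈ s ↔ ∃ i, v ∈ (c i).leaves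
  adj_same : ∀ i, ∀ v ∈ (c i).leaves, ∀ w ∈ (c i).leaves, ((c i).Adj v w ↔ G.Adj v w)
  adj_cross : ∀ i j, i ≠ j → ∀ v ∈ (c i).leaves, ∀ w ∈ (c j).leaves, (G.Adj v w ↔ b = true)

/-- A cotree whose root is labelled `b` is cut into the subtrees at the children of the root; any
other cotree is a forest by itself. -/
theorem Represents.exists_forest {T : Cotree V} {G : SimpleGraph V} {s : Set V}
    (h : T.Represents G s) (b : Bool) :
    ∃ (ι : Type) (_ : Finite ι) (_ : Nonempty ι) (c : ι → Cotree V), IsForest c b G s := by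
  by_cases hb : T.rootLabel = some b
  · cases T with
    | leaf v => simp [rootLabel] at hb
    | node b' k c =>
      obtain rfl : b' = b := by simpa [rootLabel] using hb
      have hmem : ∀ v, v ∈ s ↔ ∃ i, v ∈ (c i).leaves := fun v => by
        rw [← h.leaves_eq, mem_leaves_node]
      refine ⟨Fin k, inferInstance, ⟨⟨0, by have := h.proper.1; omega⟩⟩, c, h.proper.2.2,
        h.alternating, h.proper.2.1, hmem, fun i v hv w hw => ?_, fun i j hij v hv w hw => ?_⟩
      · rw [← h.adj_iff v ((hmem v).2 ⟨i, hv⟩) w ((hmem w).2 ⟨i, hw⟩), h.proper.adj_same hv hw]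
      · rw [← h.adj_iff v ((hmem v).2 ⟨i, hv⟩) w ((hmem w).2 ⟨j, hw⟩), h.proper.adj_cross hij hv hw]
  · refine ⟨Unit, inferInstance, inferInstance, fun _ => T, fun _ => h.proper,
      fun _ => ⟨hb, h.alternating⟩, fun i j hij => absurd rfl hij, fun v => by simp [h.leaves_eq],
      fun _ v hv w hw => ?_, fun i j hij => absurd rfl hij⟩
    rw [h.leaves_eq] at hv hw
    exact h.adj_iff v hv w hw

theorem IsForest.exists_cotree {ι : Type} [Finite ι] [Nontrivial ι] {c : ι → Cotree V} {b : Bool}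
    {G : SimpleGraph V} {s : Set V} (h : IsForest c b G s) : ∃ T : Cotree V, T.Represents G s := by
  obtain ⟨k, ⟨e⟩⟩ := Finite.exists_equiv_fin ι
  have hk : 1 < k := Fin.nontrivial_iff_two_le.1 e.symm.nontrivial
  have hP : (node b k fun i => c (e.symm i)).Proper :=
    ⟨hk, fun i j hij => h.disjoint (e.symm.injective.ne hij), fun i => h.proper _⟩
  have hmem : ∀ v, v ∈ s ↔ ∃ i, v ∈ (c (e.symm i)).leaves := fun v =>
    (h.mem_iff v).trans e.symm.surjective.exists
  refine ⟨_, hP, fun i => h.alternating _,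
    Set.ext fun v => mem_leaves_node.trans (hmem v).symm, fun v hv w hw => ?_⟩
  obtain ⟨i, hi⟩ := (hmem v).1 hv
  obtain ⟨j, hj⟩ := (hmem w).1 hw
  by_cases hij : i = j
  · subst hij
    rw [hP.adj_same hi hj, h.adj_same _ v hi w hj]
  · rw [hP.adj_cross hij hi hj, h.adj_cross _ _ (e.symm.injective.ne hij) v hi w hj]

theorem IsForest.append {ι κ : Type} {c : ι → Cotree V} {d : κ → Cotree V} {b : Bool}
    {G : SimpleGraph V} {s t : Set V} (hc : IsForest c b G s) (hd : IsForest d b G t)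
    (hst : Disjoint s t) (hb : ∀ v ∈ s, ∀ w ∈ t, (G.Adj v w ↔ b = true)) :
    IsForest (Sum.elim c d) b G (s ∪ t) := by
  have hs : ∀ {v i}, v ∈ (c i).leaves → v ∈ s := fun h => (hc.mem_iff _).2 ⟨_, h⟩
  have ht : ∀ {v i}, v ∈ (d i).leaves → v ∈ t := fun h => (hd.mem_iff _).2 ⟨_, h⟩
  refine ⟨?_, ?_, ?_, ?_, ?_, ?_⟩
  · exact Sum.rec hc.proper hd.proper
  · exact Sum.rec hc.alternating hd.alternating
  · rintro (i | i) (j | j) hij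
    · exact hc.disjoint fun e => hij (congrArg Sum.inl e)
    · exact hst.mono (fun _ h => hs h) fun _ h => ht h
    · exact hst.symm.mono (fun _ h => ht h) fun _ h => hs h
    · exact hd.disjoint fun e => hij (congrArg Sum.inr e)
  · intro v
    rw [Set.mem_union, hc.mem_iff, hd.mem_iff, Sum.exists]
    rfl
  · exact Sum.rec hc.adj_same hd.adj_same
  · rintro (i | i) (j | j) hij v hv w hw
    · exact hc.adj_cross i j (fun e => hij (congrArg Sum.inl e)) v hv w hw
    · exact hb v (hs hv) w (ht hw)
    · rw [G.adj_comm]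
      exact hb w (hs hw) v (ht hv)
    · exact hd.adj_cross i j (fun e => hij (congrArg Sum.inr e)) v hv w hw

theorem exists_represents [DecidableEq V] {G : SimpleGraph V} (hG : HasSplits G) (s : Finset V)
    (hs : s.Nonempty) : ∃ T : Cotree V, T.Represents G s := by
  induction s using Finset.strongInduction with
  | H s ih =>
    obtain ⟨a, rfl⟩ | hnt := hs.exists_eq_singleton_or_nontrivial
    · refine ⟨leaf a, trivial, trivial, by simp [leaves], fun v hv w hw => ?_⟩
      simp only [Finset.coe_singleton, Set.mem_singleton_iff] at hv hw
      simp [Adj, hv, hw]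
    · obtain ⟨t, hts, ht, b, hb⟩ := hG.exists_finset hnt
      obtain ⟨T₁, h₁⟩ := ih t hts ht
      obtain ⟨T₂, h₂⟩ := ih (s \ t) (Finset.sdiff_ssubset hts.1 ht)
        (Finset.sdiff_nonempty.2 hts.2)
      obtain ⟨ι, _, _, c, hc⟩ := h₁.exists_forest b
      obtain ⟨κ, _, _, d, hd⟩ := h₂.exists_forest b
      have := hc.append hd (Finset.disjoint_coe.2 Finset.disjoint_sdiff) fun v hv w hw => by
        rw [Finset.mem_coe, Finset.mem_sdiff] at hw
        exact hb v hv w hw.1 hw.2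
      rw [← Finset.coe_union, Finset.union_sdiff_of_subset hts.1] at this
      have : Nontrivial (ι ⊕ κ) :=
        ⟨.inl (Classical.arbitrary ι), .inr (Classical.arbitrary κ), by simp⟩
      exact IsForest.exists_cotree ‹_›

end Cotree

/-- In a cograph with more than one vertex, siblings and twins are the same, whatever cotree is used
to tell siblings. -/
theorem siblings_iff_twins {V : Type u} [Fintype V] [DecidableEq V] {G : SimpleGraph V}
    (hcard : 1 < Fintype.card V) (hG : HasSplits G) {v w : V} : Siblings G v w ↔ Twins G v w := by
  constructor
  · rintro ⟨T, hT, h⟩ u huv huw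
    rw [← hT.adj_iff, ← hT.adj_iff]
    exact h.adj_iff hT.proper (hT.leaves_eq ▸ Set.mem_univ u) huv huw
  · intro h
    obtain ⟨T, hT⟩ := Cotree.exists_represents hG Finset.univ ⟨v, Finset.mem_univ v⟩
    rw [Finset.coe_univ] at hT
    have hadj : ∀ v w, T.Adj v w ↔ G.Adj v w := fun v w => hT.adj_iff v trivial w trivial
    have hmem : ∀ v, v ∈ T.leaves := fun v => hT.leaves_eq ▸ Set.mem_univ v
    refine ⟨T, ⟨hT.proper, hT.alternating, hT.leaves_eq, hadj⟩, ?_⟩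
    by_cases hvw : v = w
    · subst hvw
      refine Cotree.sameParent_self (hmem v) ?_
      rintro x rfl
      obtain ⟨y, hy⟩ := Fintype.exists_ne_of_one_lt_card hcard x
      exact hy (hmem y)
    · refine Cotree.sameParent_of_twins hT.proper hT.alternating hvw (hmem v) (hmem w) ?_
      intro u _ huv huw
      rw [hadj, hadj]
      exact h u huv huw

/-! ### Eigenvectors of the Laplacian of a cograph -/

section Laplacian

variable {V : Type u} {G : SimpleGraph V}

open Classical in
/-- The Laplacian of the subgraph of `G` induced on `s`, applied to the restriction of `x` to `s`. The
value is meaningful at the vertices of `s` only. -/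
noncomputable def inducedLap (G : SimpleGraph V) (s : Finset V) (x : V → ℝ) (v : V) : ℝ :=
  ∑ w ∈ s, if G.Adj v w then x v - x w else 0

theorem sum_inducedLap (G : SimpleGraph V) (s : Finset V) (x : V → ℝ) :
    ∑ v ∈ s, inducedLap G s x v = 0 := by
  classical
  have h : ∑ v ∈ s, inducedLap G s x v = -∑ v ∈ s, inducedLap G s x v := by
    simp only [inducedLap]
    conv_rhs => rw [Finset.sum_comm]
    simp only [← Finset.sum_neg_distrib]
    refine Finset.sum_congr rfl fun v _ => Finset.sum_congr rfl fun w _ => ?_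
    rw [G.adj_comm w v]
    split_ifs <;> ring
  linarith

open Classical in
/-- The Dirichlet form is twice the quadratic form of the Laplacian. -/
theorem two_mul_sum_mul_inducedLap (G : SimpleGraph V) (s : Finset V) (x : V → ℝ) :
    2 * ∑ v ∈ s, x v * inducedLap G s x v =
      ∑ v ∈ s, ∑ w ∈ s, if G.Adj v w then (x v - x w) ^ 2 else 0 := by
  have h : ∑ v ∈ s, x v * inducedLap G s x v =
      ∑ v ∈ s, ∑ w ∈ s, if G.Adj v w then x v * (x v - x w) else 0 := by
    simp only [inducedLap, Finset.mul_sum, mul_ite, mul_zero]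
  rw [two_mul, congrArg₂ (· + ·) h (h.trans Finset.sum_comm), ← Finset.sum_add_distrib]
  refine Finset.sum_congr rfl fun v _ => ?_
  rw [← Finset.sum_add_distrib]
  refine Finset.sum_congr rfl fun w _ => ?_
  rw [G.adj_comm w v]
  split_ifs <;> ring

theorem eq_of_adj_of_inducedLap_eq_zero {s : Finset V} {x : V → ℝ}
    (hx : ∀ v ∈ s, inducedLap G s x v = 0) {v w : V} (hv : v ∈ s) (hw : w ∈ s) (h : G.Adj v w) :
    x v = x w := by
  classical
  have h₀ := two_mul_sum_mul_inducedLap G s x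
  have hnn : ∀ a b, (0 : ℝ) ≤ if G.Adj a b then (x a - x b) ^ 2 else 0 := fun a b => by
    split_ifs <;> positivity
  rw [Finset.sum_eq_zero fun v hv => by rw [hx v hv, mul_zero], mul_zero, eq_comm,
    Finset.sum_eq_zero_iff_of_nonneg fun a _ => Finset.sum_nonneg fun b _ => hnn a b] at h₀
  have h₁ := (Finset.sum_eq_zero_iff_of_nonneg fun b _ => hnn v b).1 (h₀ v hv) w hw
  rw [if_pos h] at h₁
  exact sub_eq_zero.1 (pow_eq_zero_iff two_ne_zero |>.1 h₁)

theorem inducedLap_compl (s : Finset V) (x : V → ℝ) (v : V) :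
    inducedLap Gᶜ s x v = s.card * x v - ∑ w ∈ s, x w - inducedLap G s x v := by
  classical
  have : (s.card : ℝ) * x v - ∑ w ∈ s, x w = ∑ w ∈ s, (x v - x w) := by
    rw [Finset.sum_sub_distrib, Finset.sum_const, nsmul_eq_mul]
  rw [this, inducedLap, inducedLap, ← Finset.sum_sub_distrib]
  refine Finset.sum_congr rfl fun w _ => ?_
  by_cases hvw : v = w
  · simp [hvw]
  · by_cases h : G.Adj v w <;> simp [SimpleGraph.compl_adj, hvw, h]

theorem inducedLap_subset {s t : Finset V} (hts : t ⊆ s) (x : V → ℝ) {v : V}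
    (h : ∀ w ∈ s, w ∉ t → ¬ G.Adj v w) : inducedLap G t x v = inducedLap G s x v := by
  classical
  exact Finset.sum_subset hts fun w hw hwt => if_neg (h w hw hwt)

/-- The set `S` contains all but at most one vertex of each class of twins. -/
def MeetsTwins (G : SimpleGraph V) (S : Finset V) : Prop :=
  ∀ v w, v ≠ w → Twins G v w → v ∈ S ∨ w ∈ S

theorem meetsTwins_compl {S : Finset V} : MeetsTwins Gᶜ S ↔ MeetsTwins G S := by
  simp only [MeetsTwins, twins_compl]

theorem MeetsTwins.not_nontrivial_of_isModule [DecidableEq V] (hG : HasSplits G) {S U : Finset V}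
    (hS : MeetsTwins G S) (hU : IsModule G U) (hUS : Disjoint U S) : ¬ U.Nontrivial := by
  intro hnt
  obtain ⟨v, hv, w, hw, hvw, h⟩ := hU.exists_twins hG hnt
  rcases hS v w hvw h with hvS | hwS
  · exact Finset.disjoint_left.1 hUS hv hvS
  · exact Finset.disjoint_left.1 hUS hw hwS

/-- A vector on a module `s` that is harmonic on `s` and vanishes on `S` is supported on at most one
vertex: it is constant along edges, so that its support is a module. -/
theorem not_nontrivial_support [DecidableEq V] (hG : HasSplits G) {S s : Finset V}
    (hS : MeetsTwins G S) (hs : IsModule G s) {x : V → ℝ}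
    (hx : ∀ v ∈ s, inducedLap G s x v = 0) (hxS : ∀ v ∈ s, v ∈ S → x v = 0) :
    ¬ {v ∈ s | x v ≠ 0}.Nontrivial := by
  refine hS.not_nontrivial_of_isModule hG
    (hs.subset (Finset.filter_subset _ _) False fun v hv w hw hwt => ?_) ?_
  · rw [Finset.mem_filter] at hv
    refine iff_false_intro fun h => hwt (Finset.mem_filter.2 ⟨hw, ?_⟩)
    rw [← eq_of_adj_of_inducedLap_eq_zero hx hv.1 hw h]
    exact hv.2
  · rw [Finset.disjoint_left]
    intro v hv hvS
    rw [Finset.mem_filter] at hv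
    exact hv.2 (hxS v hv.1 hvS)

theorem eq_zero_of_sum_eq_zero {s : Finset V} {x : V → ℝ} (hsum : ∑ v ∈ s, x v = 0)
    (h : ¬ {v ∈ s | x v ≠ 0}.Nontrivial) : ∀ v ∈ s, x v = 0 := by
  intro v hv
  by_contra hne
  rw [Finset.sum_eq_single_of_mem v hv fun w hw hwv => ?_] at hsum
  · exact hne hsum
  · by_contra hw'
    exact h ⟨w, by simp [hw, hw'], v, by simp [hv, hne], hwv⟩

/-- The inductive step for a module `s` that is cut into two parts without edges between them. -/
theorem eq_zero_of_eigenvector_of_no_edges [DecidableEq V] (hG : HasSplits G) {S s t : Finset V}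
    (hS : MeetsTwins G S) (hs : IsModule G s) (hts : t ⊂ s) (ht : t.Nonempty)
    (hno : ∀ v ∈ t, ∀ w ∈ s, w ∉ t → ¬ G.Adj v w)
    (ih : ∀ r ⊂ s, IsModule G r → ∀ (μ : ℝ) (x : V → ℝ), ∑ v ∈ r, x v = 0 →
      (∀ v ∈ r, inducedLap G r x v = μ * x v) → (∀ v ∈ r, v ∈ S → x v = 0) → ∀ v ∈ r, x v = 0)
    {μ : ℝ} {x : V → ℝ} (hsum : ∑ v ∈ s, x v = 0)
    (hx : ∀ v ∈ s, inducedLap G s x v = μ * x v) (hxS : ∀ v ∈ s, v ∈ S → x v = 0) :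
    ∀ v ∈ s, x v = 0 := by
  by_cases hμ : μ = 0
  · exact eq_zero_of_sum_eq_zero hsum <|
      not_nontrivial_support hG hS hs (fun v hv => by rw [hx v hv, hμ, zero_mul]) hxS
  -- both parts inherit all hypotheses; in particular, nonzero eigenvalues force the sums to vanish
  have key : ∀ r ⊂ s, (∀ v ∈ r, ∀ w ∈ s, w ∉ r → ¬ G.Adj v w) → ∀ v ∈ r, x v = 0 := by
    intro r hr hno
    have hxr : ∀ v ∈ r, inducedLap G r x v = μ * x v := fun v hv => by
      rw [inducedLap_subset hr.1 x (hno v hv), hx v (hr.1 hv)]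
    refine ih r hr (hs.subset hr.1 False fun v hv w hw hwr => iff_false_intro (hno v hv w hw hwr))
      μ x ?_ hxr fun v hv => hxS v (hr.1 hv)
    have := sum_inducedLap G r x
    rw [Finset.sum_congr rfl hxr, ← Finset.mul_sum] at this
    exact (mul_eq_zero.1 this).resolve_left hμ
  intro v hv
  by_cases hvt : v ∈ t
  · exact key t hts hno v hvt
  · refine key (s \ t) (Finset.sdiff_ssubset hts.1 ht) (fun v hv w hw hwr h => ?_) v (by simp [hv, hvt])
    simp only [Finset.mem_sdiff] at hv hwr
    exact hno w (by tauto) v hv.1 hv.2 h.symm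

/-- On a module of a cograph, an eigenvector of the induced Laplacian with zero sum is determined by
its values on all but one vertex of each class of twins. -/
theorem eq_zero_of_eigenvector [DecidableEq V] (hG : HasSplits G) {S : Finset V}
    (hS : MeetsTwins G S) (s : Finset V) (hs : IsModule G s) (μ : ℝ) (x : V → ℝ)
    (hsum : ∑ v ∈ s, x v = 0) (hx : ∀ v ∈ s, inducedLap G s x v = μ * x v)
    (hxS : ∀ v ∈ s, v ∈ S → x v = 0) : ∀ v ∈ s, x v = 0 := by
  induction s using Finset.strongInduction generalizing μ x with
  | H s ih =>
    by_cases hnt : s.Nontrivial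
    · obtain ⟨t, hts, ht, b, hb⟩ := hG.exists_finset hnt
      cases b with
      | false =>
        exact eq_zero_of_eigenvector_of_no_edges hG hS hs hts ht
          (fun v hv w hw hwt => by simp [hb v hv w hw hwt]) ih hsum hx hxS
      | true =>
        -- for vectors with zero sum, complementation replaces the eigenvalue `μ` by `|s| - μ`
        have hc : ∀ (r : Finset V) (H : SimpleGraph V) (ν : ℝ) (y : V → ℝ), ∑ v ∈ r, y v = 0 →
            (∀ v ∈ r, inducedLap H r y v = ν * y v) →
            ∀ v ∈ r, inducedLap Hᶜ r y v = (r.card - ν) * y v := by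
          intro r H ν y hy h v hv
          rw [inducedLap_compl, h v hv, hy]
          ring
        refine eq_zero_of_eigenvector_of_no_edges hG.compl (meetsTwins_compl.2 hS)
          (isModule_compl.2 hs) hts ht (fun v hv w hw hwt => ?_) (fun r hr hrm ν y hy h => ?_) hsum
          (hc s G μ x hsum hx) hxS
        · simp [SimpleGraph.compl_adj, hb v hv w hw hwt]
        · refine ih r hr (isModule_compl.1 hrm) (r.card - ν) y hy ?_
          simpa using hc r Gᶜ ν y hy h
    · exact eq_zero_of_sum_eq_zero hsum fun h => hnt (h.mono (Finset.filter_subset _ _))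

open Matrix in
theorem lapMatrix_mulVec_eq_inducedLap [Fintype V] [DecidableEq V] [DecidableRel G.Adj]
    (x : V → ℝ) (v : V) : (G.lapMatrix ℝ *ᵥ x) v = inducedLap G Finset.univ x v := by
  have h : inducedLap G Finset.univ x v = ∑ w ∈ G.neighborFinset v, (x v - x w) := by
    rw [SimpleGraph.neighborFinset_eq_filter, Finset.sum_filter, inducedLap]
    congr!
  rw [h, SimpleGraph.lapMatrix_mulVec_apply, Finset.sum_sub_distrib, Finset.sum_const, nsmul_eq_mul,
    SimpleGraph.degree]

open Matrix in
/-- No eigenvector of the Laplacian of a connected cograph vanishes on all but one vertex of each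
class of twins. -/
theorem eq_zero_of_lapMatrix_eigenvector [Fintype V] [DecidableEq V] [DecidableRel G.Adj]
    (hcard : 1 < Fintype.card V) (hG : HasSplits G) (hconn : G.Connected) {S : Finset V}
    (hS : MeetsTwins G S) {μ : ℝ} {x : V → ℝ} (hx : G.lapMatrix ℝ *ᵥ x = μ • x)
    (hxS : ∀ v ∈ S, x v = 0) : x = 0 := by
  have hx' : ∀ v ∈ Finset.univ, inducedLap G Finset.univ x v = μ * x v := fun v _ => by
    rw [← lapMatrix_mulVec_eq_inducedLap, hx, Pi.smul_apply, smul_eq_mul]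
  have huniv : IsModule G Finset.univ := fun u hu => absurd (Finset.mem_univ u) hu
  by_cases hμ : μ = 0
  · -- the vector is constant, and supported on at most one vertex
    have h₀ : ∀ v ∈ Finset.univ, inducedLap G Finset.univ x v = 0 := fun v hv => by
      rw [hx' v hv, hμ, zero_mul]
    have hsub := not_nontrivial_support hG hS huniv h₀ fun v _ => hxS v
    have hconst : ∀ v w, x v = x w := fun v w =>
      (G.lapMatrix_mulVec_eq_zero_iff_forall_reachable.1 (by rw [hx, hμ, zero_smul])) v w
        (hconn.preconnected v w)
    by_contra hne
    obtain ⟨v, hv⟩ := Function.ne_iff.1 hne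
    obtain ⟨w, hw⟩ := Fintype.exists_ne_of_one_lt_card hcard v
    exact hsub ⟨v, by simpa using hv, w, by simpa [hconst w v] using hv, hw.symm⟩
  · have hsum := sum_inducedLap G Finset.univ x
    rw [Finset.sum_congr rfl hx', ← Finset.mul_sum] at hsum
    exact funext fun v => eq_zero_of_eigenvector hG hS _ huniv μ x
      ((mul_eq_zero.1 hsum).resolve_left hμ) hx' (fun v _ => hxS v) v (Finset.mem_univ v)

open Matrix in
/-- For twins `v` and `w` the difference of basis vectors `e_v - e_w` is an eigenvector. -/
theorem Twins.exists_lapMatrix_eigenvector [Fintype V] [DecidableEq V] [DecidableRel G.Adj]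
    {v w : V} (h : Twins G v w) (hvw : v ≠ w) :
    ∃ μ : ℝ, G.lapMatrix ℝ *ᵥ (Pi.single v 1 - Pi.single w 1) =
      μ • (Pi.single v 1 - Pi.single w 1 : V → ℝ) := by
  have happ : ∀ u, (G.lapMatrix ℝ *ᵥ (Pi.single v 1 - Pi.single w 1)) u =
      G.lapMatrix ℝ u v - G.lapMatrix ℝ u w := fun u => by
    simp [Matrix.mulVec_sub]
  have hoff : ∀ u, u ≠ v → u ≠ w → G.lapMatrix ℝ u v - G.lapMatrix ℝ u w = 0 := by
    intro u huv huw
    simp [SimpleGraph.lapMatrix, SimpleGraph.degMatrix, SimpleGraph.adjMatrix_apply, huv, huw,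
      h u huv huw]
  -- the entries of `L (e_v - e_w)` at `v` and `w` are opposite, because all entries add up to zero
  have hsum : (G.lapMatrix ℝ v v - G.lapMatrix ℝ v w) +
      (G.lapMatrix ℝ w v - G.lapMatrix ℝ w w) = 0 := by
    rw [← Finset.sum_eq_add (s := Finset.univ) v w
      (f := fun u => G.lapMatrix ℝ u v - G.lapMatrix ℝ u w) hvw
      (fun u _ hu => hoff u hu.1 hu.2) (by simp) (by simp)]
    simp only [← happ, lapMatrix_mulVec_eq_inducedLap]
    exact sum_inducedLap G _ _
  refine ⟨G.lapMatrix ℝ v v - G.lapMatrix ℝ v w, funext fun u => ?_⟩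
  rw [happ]
  by_cases huv : u = v
  · subst huv
    simp [hvw]
  by_cases huw : u = w
  · subst huw
    simp only [Pi.smul_apply, Pi.sub_apply, Pi.single_eq_same, Pi.single_eq_of_ne huv, smul_eq_mul]
    linarith
  · simp [hoff u huv huw, huv, huw]

end Laplacian

/-! ### Controllability of symmetric systems -/

section Control

open ContinuousLinearMap

variable {E F : Type*} [NormedAddCommGroup E] [InnerProductSpace ℝ E] [FiniteDimensional ℝ E]
  [NormedAddCommGroup F] [InnerProductSpace ℝ F] [FiniteDimensional ℝ F]

/-- If the free motion `exp (-s A) c` is invisible to `B†` for `0 ≤ s ≤ 1` and no eigenvector of `A`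
is invisible to `B†`, then `c = 0`: the invisible initial states form an `A`-invariant subspace, which
contains an eigenvector of `A` unless it is zero. -/
theorem eq_zero_of_forall_adjoint_exp_eq_zero {A : E →L[ℝ] E} (hA : A.toLinearMap.IsSymmetric)
    (B : F →L[ℝ] E) (h : ∀ (μ : ℝ) (v : E), A v = μ • v → adjoint B v = 0 → v = 0) {c : E}
    (hc : ∀ s ∈ Set.Icc (0 : ℝ) 1, adjoint B (NormedSpace.exp (s • -A) c) = 0) : c = 0 := by
  let K : Submodule ℝ E :=
    { carrier := {c | ∀ s ∈ Set.Icc (0 : ℝ) 1, adjoint B (NormedSpace.exp (s • -A) c) = 0}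
      add_mem' := fun ha hb s hs => by rw [map_add, map_add, ha s hs, hb s hs, add_zero]
      zero_mem' := fun s _ => by simp
      smul_mem' := fun r a ha s hs => by rw [map_smul, map_smul, ha s hs, smul_zero] }
  have hK : ∀ v ∈ K, A.toLinearMap v ∈ K := by
    intro v hv s hs
    have hd : HasDerivAt (fun s : ℝ => adjoint B (NormedSpace.exp (s • -A) v))
        (adjoint B ((NormedSpace.exp (s • -A) * -A) v)) s := by
      have := (hasDerivAt_exp_smul_const (-A) s).clm_apply (hasDerivAt_const s v)
      have := (adjoint B).hasFDerivAt.comp_hasDerivAt s this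
      simpa [Function.comp_def] using this
    have h₀ : HasDerivWithinAt (fun s : ℝ => adjoint B (NormedSpace.exp (s • -A) v)) 0
        (Set.Icc 0 1) s :=
      (hasDerivWithinAt_const s (Set.Icc 0 1) (0 : F)).congr hv (hv s hs)
    have := (uniqueDiffOn_Icc one_pos s hs).eq_deriv _ hd.hasDerivWithinAt h₀
    simpa using this
  have hbot : K = ⊥ := by
    by_contra hne
    have : Nontrivial K := Submodule.nontrivial_iff_ne_bot.2 hne
    obtain ⟨⟨v, hvK⟩, hv⟩ :=
      (hA.restrict_invariant hK).hasEigenvalue_iSup_of_finiteDimensional.exists_hasEigenvector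
    have hv₁ := congrArg Subtype.val hv.apply_eq_smul
    refine hv.2 (Subtype.ext (h _ v hv₁ ?_))
    simpa using hvK 0 (by simp)
  exact (Submodule.mem_bot ℝ).1 (hbot ▸ (show c ∈ K from hc))

/-- Sufficiency in the Hautus test for a symmetric system: if no eigenvector of `A` lies in the kernel
of the adjoint of `B`, then the controllability Gramian is invertible, and
`u s = B† exp (-s A) c` with a suitable `c` steers the system from `x₀` to `x₁` in unit time. -/
theorem exists_control_of_symmetric {A : E →L[ℝ] E} (hA : A.toLinearMap.IsSymmetric)
    (B : F →L[ℝ] E) (h : ∀ (μ : ℝ) (v : E), A v = μ • v → adjoint B v = 0 → v = 0) (x₀ x₁ : E) :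
    ∃ (u : ℝ → F) (x : ℝ → E), Continuous u ∧ (∀ t, HasDerivAt x (A (x t) + B (u t)) t) ∧
      x 0 = x₀ ∧ x 1 = x₁ := by
  have : CompleteSpace E := FiniteDimensional.complete ℝ E
  set Φ : ℝ → E →L[ℝ] E := fun s => NormedSpace.exp (s • -A) with hΦ
  have hΦc : Continuous Φ :=
    continuous_iff_continuousAt.2 fun s => (hasDerivAt_exp_smul_const (-A) s).continuousAt
  have hΦA : ∀ s, adjoint (Φ s) = Φ s := by
    intro s
    have hA' : IsSelfAdjoint A := isSelfAdjoint_iff_isSymmetric.2 hA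
    exact ((IsSelfAdjoint.all s).smul hA'.neg).exp
  set W : E →L[ℝ] E := ∫ s in (0 : ℝ)..1, Φ s ∘L B ∘L adjoint B ∘L Φ s with hW
  have hcont : Continuous fun s => Φ s ∘L B ∘L adjoint B ∘L Φ s := by fun_prop
  have hWc : ∀ c, W c = ∫ s in (0 : ℝ)..1, Φ s (B (adjoint B (Φ s c))) := fun c =>
    ContinuousLinearMap.intervalIntegral_apply (hcont.intervalIntegrable 0 1) c
  have hinj : Function.Injective W.toLinearMap := by
    refine (injective_iff_map_eq_zero _).2 fun c hc => ?_
    refine eq_zero_of_forall_adjoint_exp_eq_zero hA B h fun s hs => ?_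
    by_contra hne
    have hcf : Continuous fun s => ‖adjoint B (Φ s c)‖ ^ 2 := by fun_prop
    have hpos : 0 < ∫ s in (0 : ℝ)..1, ‖adjoint B (Φ s c)‖ ^ 2 :=
      intervalIntegral.integral_pos one_pos hcf.continuousOn (fun _ _ => by positivity)
        ⟨s, hs, by have := norm_pos_iff.2 hne; positivity⟩
    -- the quadratic form of the Gramian is the energy of the output
    have hquad : inner ℝ c (W c) = ∫ s in (0 : ℝ)..1, ‖adjoint B (Φ s c)‖ ^ 2 := by
      have hcg : Continuous fun s => Φ s (B (adjoint B (Φ s c))) := by fun_prop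
      rw [hWc, ← innerSL_apply_apply ℝ c,
        ← (innerSL ℝ c).intervalIntegral_comp_comm (hcg.intervalIntegrable 0 1)]
      refine intervalIntegral.integral_congr fun s _ => ?_
      simp only [innerSL_apply_apply]
      rw [← real_inner_self_eq_norm_sq, adjoint_inner_left, ← adjoint_inner_left (Φ s), hΦA,
        real_inner_comm]
    rw [show W c = 0 from hc, inner_zero_right] at hquad
    exact hpos.ne hquad
  have hsurj : Function.Surjective W.toLinearMap := LinearMap.injective_iff_surjective.1 hinj
  have hmul : ∀ t, NormedSpace.exp (t • A) * Φ t = 1 := by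
    intro t
    have hcomm : Commute (t • A) (t • -A) := by
      rw [smul_neg]; exact (Commute.refl _).neg_right
    let _ := NormedAlgebra.restrictScalars ℚ ℝ (E →L[ℝ] E)
    rw [hΦ, ← NormedSpace.exp_add_of_commute hcomm]
    simp
  obtain ⟨c, hc⟩ := hsurj (Φ 1 x₁ - x₀)
  set g : ℝ → E := fun s => Φ s (B (adjoint B (Φ s c))) with hg
  have hgc : Continuous g := by fun_prop
  refine ⟨fun s => adjoint B (Φ s c),
    fun t => NormedSpace.exp (t • A) (x₀ + ∫ s in (0 : ℝ)..t, g s), by fun_prop, fun t => ?_, by simp,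
    ?_⟩
  · have hi := (hgc.integral_hasStrictDerivAt 0 t).hasDerivAt.const_add x₀
    convert (hasDerivAt_exp_smul_const' A t).clm_apply hi using 2
    · rfl
    · exact (congrArg (fun M : E →L[ℝ] E => M (B (adjoint B (Φ t c)))) (hmul t)).symm
  · have : x₀ + ∫ s in (0 : ℝ)..1, g s = Φ 1 x₁ := by
      rw [← hWc, show W c = _ from hc]; abel
    refine (congrArg _ this).trans ?_
    exact congrArg (fun M : E →L[ℝ] E => M x₁) (hmul 1)

end Control

open Matrix in
/-- Hautus test, sufficiency, for a symmetric state matrix. -/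
theorem isControllable_of_isSymm {N M : Type*} [Fintype N] [Fintype M] {A : Matrix N N ℝ}
    (hA : A.IsSymm) (B : Matrix N M ℝ)
    (h : ∀ (μ : ℝ) (v : N → ℝ), A *ᵥ v = μ • v → Bᵀ *ᵥ v = 0 → v = 0) : IsControllable A B := by
  classical
  have hB : Bᴴ = Bᵀ := conjTranspose_eq_transpose_of_trivial B
  have hA' : A.IsHermitian := by
    rw [IsHermitian, conjTranspose_eq_transpose_of_trivial, hA]
  have hobs : ∀ (μ : ℝ) (v : EuclideanSpace ℝ N), (toEuclideanLin A).toContinuousLinearMap v = μ • v →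
      ContinuousLinearMap.adjoint (toEuclideanLin B).toContinuousLinearMap v = 0 → v = 0 := by
    intro μ v hv hBv
    have e : ContinuousLinearMap.adjoint (toEuclideanLin B).toContinuousLinearMap v =
        toEuclideanLin Bᴴ v := by
      rw [toEuclideanLin_conjTranspose_eq_adjoint]
      rfl
    rw [e, hB] at hBv
    exact congrArg (WithLp.toLp 2)
      (h μ v.ofLp (congrArg WithLp.ofLp hv) (congrArg WithLp.ofLp hBv))
  intro x₀ x₁
  obtain ⟨u, x, hu, hx, h₀, h₁⟩ := exists_control_of_symmetric
    (isSymmetric_toEuclideanLin_iff.2 hA') _ hobs (WithLp.toLp 2 x₀) (WithLp.toLp 2 x₁)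
  refine ⟨1, one_pos, fun t => (u t).ofLp, fun t => (x t).ofLp, ?_, fun t _ => ?_, by simp [h₀],
    by simp [h₁]⟩
  · exact ((PiLp.continuous_ofLp 2 _).comp hu).continuousOn
  · have := (EuclideanSpace.equiv N ℝ).toContinuousLinearMap.hasFDerivAt.comp_hasDerivAt t (hx t)
    exact this.hasDerivWithinAt

open Matrix in
/-- Hautus test, necessity: along an eigenvector `v` of `Aᵀ` that is orthogonal to the columns of `B`,
the state follows `z' = μ z` whatever the input is. -/
theorem IsControllable.eq_zero {N M : Type*} [Fintype N] [Fintype M] {A : Matrix N N ℝ}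
    {B : Matrix N M ℝ} (h : IsControllable A B) {μ : ℝ} {v : N → ℝ} (hv : Aᵀ *ᵥ v = μ • v)
    (hB : Bᵀ *ᵥ v = 0) : v = 0 := by
  obtain ⟨T, hT, u, x, -, hx, h₀, h₁⟩ := h 0 v
  have hz : ∀ t ∈ Set.Icc 0 T,
      HasDerivWithinAt (fun t => v ⬝ᵥ x t) (μ * (v ⬝ᵥ x t)) (Set.Icc 0 T) t := by
    intro t ht
    have h₁ : HasDerivWithinAt (fun t => v ⬝ᵥ x t) (v ⬝ᵥ (A *ᵥ x t + B *ᵥ u t)) (Set.Icc 0 T) t :=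
      HasDerivWithinAt.fun_sum fun i _ => (hasDerivWithinAt_pi.1 (hx t ht) i).const_mul (v i)
    convert h₁ using 1
    rw [dotProduct_add, dotProduct_mulVec, dotProduct_mulVec, ← mulVec_transpose, ← mulVec_transpose,
      hv, hB, zero_dotProduct, add_zero, smul_dotProduct, smul_eq_mul]
  have hc : ∀ t ∈ Set.Icc 0 T, HasDerivWithinAt (fun t => Real.exp (-μ * t) * (v ⬝ᵥ x t)) 0
      (Set.Icc 0 T) t := by
    intro t ht
    have he : HasDerivWithinAt (fun t => Real.exp (-μ * t)) (Real.exp (-μ * t) * -μ)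
        (Set.Icc 0 T) t := by
      simpa using ((hasDerivWithinAt_id t _).const_mul (-μ)).exp
    exact (he.fun_mul (hz t ht)).congr_deriv (by ring)
  have hconst := (convex_Icc 0 T).norm_image_sub_le_of_norm_hasDerivWithin_le (C := 0) hc
    (fun _ _ => by simp) (Set.left_mem_Icc.2 hT.le) (Set.right_mem_Icc.2 hT.le)
  rw [zero_mul, norm_le_zero_iff, h₀, h₁, dotProduct_zero, mul_zero, sub_zero] at hconst
  exact dotProduct_self_eq_zero.1 ((mul_eq_zero.1 hconst).resolve_left (Real.exp_pos _).ne')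

open Matrix in
theorem inputMatrix_transpose_mulVec_eq_zero_iff {V : Type u} [Fintype V] [DecidableEq V]
    {S : Finset V} {x : V → ℝ} : (inputMatrix S)ᵀ *ᵥ x = 0 ↔ ∀ v ∈ S, x v = 0 := by
  have h : ∀ j : S, ((inputMatrix S)ᵀ *ᵥ x) j = x j := fun j => by
    simp [mulVec, dotProduct, inputMatrix]
  rw [funext_iff, Subtype.forall]
  exact forall₂_congr fun v hv => by rw [h ⟨v, hv⟩, Pi.zero_apply]

open Matrix in
/-- A connected cograph is controllable from `S` if and only if `S` misses at most one vertex of each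
class of twins. -/
theorem controllableFrom_iff_meetsTwins {V : Type u} [Fintype V] [DecidableEq V]
    {G : SimpleGraph V} [DecidableRel G.Adj] (hcard : 1 < Fintype.card V) (hG : HasSplits G)
    (hconn : G.Connected) {S : Finset V} : ControllableFrom G S ↔ MeetsTwins G S := by
  constructor
  · intro h v w hvw ht
    by_contra! hS
    obtain ⟨μ, hμ⟩ := ht.exists_lapMatrix_eigenvector hvw
    have hx : (Pi.single v 1 - Pi.single w 1 : V → ℝ) = 0 := by
      refine IsControllable.eq_zero (μ := -μ) h ?_ (inputMatrix_transpose_mulVec_eq_zero_iff.2 ?_)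
      · rw [transpose_neg, SimpleGraph.isSymm_lapMatrix, neg_mulVec, hμ, neg_smul]
      · intro u hu
        have hv : u ≠ v := fun e => hS.1 (e ▸ hu)
        have hw : u ≠ w := fun e => hS.2 (e ▸ hu)
        simp [hv, hw]
    simpa [hvw] using congrFun hx v
  · intro hS
    refine isControllable_of_isSymm (G.isSymm_lapMatrix (R := ℝ)).neg _ fun μ x hx hxS => ?_
    refine eq_zero_of_lapMatrix_eigenvector (μ := -μ) hcard hG hconn hS ?_
      (inputMatrix_transpose_mulVec_eq_zero_iff.1 hxS)
    rw [neg_smul, ← hx, neg_mulVec, neg_neg]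

/-! ### Counting in the sibling partition -/

section Partition

variable {V : Type u} [Fintype V] [DecidableEq V]

/-- A finite partition is determined by the relation of lying in a common cell. -/
theorem finpartition_eq_of_forall_mem_iff {π ρ : Finpartition (Finset.univ : Finset V)}
    (h : ∀ v w, (∃ C ∈ π.parts, v ∈ C ∧ w ∈ C) ↔ ∃ C ∈ ρ.parts, v ∈ C ∧ w ∈ C) : π = ρ := by
  have key : ∀ {π ρ : Finpartition (Finset.univ : Finset V)},
      (∀ v w, (∃ C ∈ π.parts, v ∈ C ∧ w ∈ C) ↔ ∃ C ∈ ρ.parts, v ∈ C ∧ w ∈ C) →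
      π.parts ⊆ ρ.parts := by
    intro π ρ h C hC
    obtain ⟨v, hv⟩ := π.nonempty_of_mem_parts hC
    have : C = ρ.part v := by
      rw [← π.part_eq_of_mem hC hv]
      ext w
      rw [π.mem_part_iff_exists, ρ.mem_part_iff_exists, h]
    rw [this]
    exact ρ.part_mem.2 (Finset.mem_univ v)
  exact Finpartition.ext ((key h).antisymm (key fun v w => (h v w).symm))

theorem existsUnique_isSiblingPartition {G : SimpleGraph V}
    (hsib : ∀ v w, Siblings G v w ↔ Twins G v w) :
    ∃! π : Finpartition (Finset.univ : Finset V), IsSiblingPartition G π := by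
  classical
  let r : Setoid V := ⟨Twins G, Twins.refl G, Twins.symm, Twins.trans⟩
  refine ⟨Finpartition.ofSetoid r, fun v w => ?_, fun π hπ =>
    finpartition_eq_of_forall_mem_iff fun v w => ?_⟩
  · rw [← Finpartition.mem_part_iff_exists, Finpartition.mem_part_ofSetoid_iff_rel, hsib]
    exact ⟨Twins.symm, Twins.symm⟩
  · rw [hπ v w, ← Finpartition.mem_part_iff_exists, Finpartition.mem_part_ofSetoid_iff_rel, hsib]
    exact ⟨Twins.symm, Twins.symm⟩

variable (π : Finpartition (Finset.univ : Finset V))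

theorem sum_card_inter_parts (S : Finset V) : ∑ C ∈ π.parts, (S ∩ C).card = S.card := by
  have h := Finset.card_biUnion (s := π.parts) (t := fun C => S ∩ C) fun C hC D hD hCD =>
    (π.disjoint hC hD hCD).mono Finset.inter_subset_right Finset.inter_subset_right
  rw [← h, ← Finset.inter_biUnion,
    show π.parts.biUnion (fun C => C) = Finset.univ from π.biUnion_parts, Finset.inter_univ]

theorem sum_card_sub_one_parts :
    ∑ C ∈ π.parts, (C.card - 1) = Fintype.card V - π.parts.card := by
  rw [Finset.sum_tsub_distrib _ fun C hC => (π.nonempty_of_mem_parts hC).card_pos,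
    π.sum_card_parts, Finset.card_univ, Finset.card_eq_sum_ones]

theorem card_sub_card_parts_le {S : Finset V}
    (h : ∀ C ∈ π.parts, C.card - 1 ≤ (S ∩ C).card) :
    Fintype.card V - π.parts.card ≤ S.card := by
  rw [← sum_card_sub_one_parts, ← sum_card_inter_parts π S]
  exact Finset.sum_le_sum h

theorem card_eq_iff_forall_card_inter_eq {S : Finset V} :
    ((∀ C ∈ π.parts, C.card - 1 ≤ (S ∩ C).card) ∧ S.card = Fintype.card V - π.parts.card) ↔
      ∀ C ∈ π.parts, (S ∩ C).card = C.card - 1 := by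
  rw [← sum_card_sub_one_parts, ← sum_card_inter_parts π S]
  constructor
  · rintro ⟨h, he⟩ C hC
    exact ((Finset.sum_eq_sum_iff_of_le h).1 he.symm C hC).symm
  · exact fun h => ⟨fun C hC => (h C hC).ge, Finset.sum_congr rfl h⟩

/-- A set that contains all but one element of each cell is given by the choice of the omitted
elements. -/
theorem ncard_setOf_card_inter_eq :
    {S : Finset V | ∀ C ∈ π.parts, (S ∩ C).card = C.card - 1}.ncard =
      ∏ C ∈ π.parts, C.card := by
  let F : (∀ C : π.parts, C.1) → Finset V := fun f => {v | ∀ C, (f C : V) ≠ v}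
  have hF : ∀ f, ∀ C : π.parts, F f ∩ C.1 = C.1.erase (f C) := by
    intro f C
    ext v
    simp only [F, Finset.mem_inter, Finset.mem_filter, Finset.mem_univ, true_and, Finset.mem_erase]
    refine and_congr_left fun hv => ⟨fun h => (h C).symm, fun h D e => h ?_⟩
    have : D = C := Subtype.ext (π.eq_of_mem_parts D.2 C.2 (e ▸ (f D).2) hv)
    rw [← this, e]
  have hinj : Function.Injective F := by
    intro f g h
    refine funext fun C => Subtype.ext ?_
    by_contra hne
    have : (f C : V) ∈ F g ∩ C.1 := by
      rw [hF]
      exact Finset.mem_erase.2 ⟨hne, (f C).2⟩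
    rw [← h, hF] at this
    exact Finset.notMem_erase _ _ this
  have hrange : {S : Finset V | ∀ C ∈ π.parts, (S ∩ C).card = C.card - 1} = Set.range F := by
    ext S
    constructor
    · intro h
      have h₁ : ∀ C : π.parts, ∃ v, C.1 \ S = {v} := fun C => by
        have h₂ := h C.1 C.2
        have := Finset.card_sdiff_add_card_inter C.1 S
        have := (π.nonempty_of_mem_parts C.2).card_pos
        rw [Finset.inter_comm] at h₂
        exact Finset.card_eq_one.1 (by omega)
      choose f hf using h₁
      have hf' : ∀ C, f C ∈ C.1 ∧ f C ∉ S := fun C =>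
        Finset.mem_sdiff.1 (hf C ▸ Finset.mem_singleton_self _)
      refine ⟨fun C => ⟨f C, (hf' C).1⟩, Finset.ext fun v => ?_⟩
      simp only [F, Finset.mem_filter, Finset.mem_univ, true_and]
      constructor
      · intro hv
        by_contra hvS
        have hp := π.part_mem.2 (Finset.mem_univ v)
        have : v ∈ π.part v \ S := Finset.mem_sdiff.2 ⟨π.mem_part (Finset.mem_univ v), hvS⟩
        rw [hf ⟨_, hp⟩, Finset.mem_singleton] at this
        exact hv _ this.symm
      · rintro hv C rfl
        exact (hf' C).2 hv
    · rintro ⟨f, rfl⟩ C hC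
      rw [hF f ⟨C, hC⟩, Finset.card_erase_of_mem (f ⟨C, hC⟩).2]
  rw [hrange, ← Set.image_univ, Set.ncard_image_of_injective _ hinj, Set.ncard_univ, Nat.card_pi]
  simp only [Nat.card_eq_fintype_card, Fintype.card_coe]
  exact Finset.prod_coe_sort π.parts Finset.card

theorem meetsTwins_iff_card_sub_one_le {G : SimpleGraph V}
    (hπ : ∀ v w, (∃ C ∈ π.parts, v ∈ C ∧ w ∈ C) ↔ Twins G v w) {S : Finset V} :
    MeetsTwins G S ↔ ∀ C ∈ π.parts, C.card - 1 ≤ (S ∩ C).card := by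
  have h : MeetsTwins G S ↔ ∀ C ∈ π.parts, (C \ S).card ≤ 1 := by
    simp only [Finset.card_le_one, Finset.mem_sdiff]
    constructor
    · intro h C hC v hv w hw
      by_contra hvw
      exact (h v w hvw ((hπ v w).1 ⟨C, hC, hv.1, hw.1⟩)).elim hv.2 hw.2
    · intro h v w hvw ht
      obtain ⟨C, hC, hv, hw⟩ := (hπ v w).2 ht
      by_contra! hS
      exact hvw (h C hC v ⟨hv, hS.1⟩ w ⟨hw, hS.2⟩)
  rw [h]
  refine forall₂_congr fun C _ => ?_
  have := Finset.card_sdiff_add_card_inter C S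
  rw [Finset.inter_comm] at this
  omega

end Partition

theorem theorem1 {V : Type u} [Fintype V] [DecidableEq V] (G : SimpleGraph V) [DecidableRel G.Adj]
    (hcard : 1 < Fintype.card V) (hcograph : IsCograph G) (hconn : G.Connected) :
    (∃! π : Finpartition (Finset.univ : Finset V), IsSiblingPartition G π) ∧
    ∀ π : Finpartition (Finset.univ : Finset V), IsSiblingPartition G π →
      IsLeast {m : ℕ | ∃ S : Finset V, S.card = m ∧ ControllableFrom G S}
        (Fintype.card V - π.parts.card) ∧
      (∀ S : Finset V,
        (ControllableFrom G S ∧ S.card = Fintype.card V - π.parts.card) ↔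
          ∀ C ∈ π.parts, (S ∩ C).card = C.card - 1) ∧
      {S : Finset V | ControllableFrom G S ∧
        S.card = Fintype.card V - π.parts.card}.ncard = ∏ C ∈ π.parts, C.card := by
  have hG := hcograph.hasSplits
  have hsib : ∀ v w, Siblings G v w ↔ Twins G v w := fun v w => siblings_iff_twins hcard hG
  refine ⟨existsUnique_isSiblingPartition hsib, fun π hπ => ?_⟩
  have hcontr : ∀ S, ControllableFrom G S ↔ ∀ C ∈ π.parts, C.card - 1 ≤ (S ∩ C).card := fun S =>
    (controllableFrom_iff_meetsTwins hcard hG hconn).trans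
      (meetsTwins_iff_card_sub_one_le π fun v w => (hπ v w).trans (hsib v w))
  have hmin : ∀ S, (ControllableFrom G S ∧ S.card = Fintype.card V - π.parts.card) ↔
      ∀ C ∈ π.parts, (S ∩ C).card = C.card - 1 := fun S => by
    rw [hcontr, card_eq_iff_forall_card_inter_eq]
  have hcount : {S : Finset V | ControllableFrom G S ∧
      S.card = Fintype.card V - π.parts.card}.ncard = ∏ C ∈ π.parts, C.card := by
    simp only [hmin, ncard_setOf_card_inter_eq]
  refine ⟨⟨?_, ?_⟩, hmin, hcount⟩
  · -- the number of minimal sets is a product of positive numbers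
    obtain ⟨S, hS, hS'⟩ := Set.nonempty_of_ncard_ne_zero (hcount.trans_ne
      (Finset.prod_ne_zero_iff.2 fun C hC => (π.nonempty_of_mem_parts hC).card_pos.ne'))
    exact ⟨S, hS', hS⟩
  · rintro _ ⟨S, rfl, hS⟩
    exact card_sub_card_parts_le π ((hcontr S).1 hS)
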